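/- Setting. A configuration is a countable set $\Pi\subset\mathbb{R}$; $\Pi(A)$ denotes the number of its points in $A$. The greedy walk on $\Pi$ is defined by $S_0=0$, $\Pi_0=\Pi$ and, for $n\ge 0$, $S_{n+1}=\arg\min\{|S_n-X| : X\in\Pi_n\}$ and $\Pi_{n+1}=\Pi_n\setminus\{S_{n+1}\}$, with ties broken arbitrarily (the statements below hold for every way of breaking them); $\Pi_\infty=\bigcap_{n\ge1}\Pi_n$ is the set of points that are never visited. The walk is called recurrent if $\operatorname{sign}(S_{n+1})\ne\operatorname{sign}(S_n)$ for infinitely many $n$, and transient otherwise. Let $\mathcal{M}$ be the set of Borel measures $\mu$ on $\mathbb{R}$ such that $\mu(-\infty,0)=\mu(0,\infty)=\infty$ and $\mu(A)<\infty$ for every bounded measurable $A$. A Poisson process with mean measure $\mu$ is a random countable set $\Pi\subset\mathbb{R}$ such that the numbers of points of $\Pi$ in disjoint measurable sets are independent and, for every measurable $A$, $\Pi(A)$ has the Poisson distribution with mean $\mu(A)$ (that is, $\Pi(A)=\infty$ almost surely if $\mu(A)=\infty$). Theorem 1. (a) Let $\mu\in\mathcal{M}$ be non-atomic (that is, $\mu(\{x\})=0$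 for all $x$), and let $\Pi$ be a Poisson process with mean measure $\mu$. If for every $R\ge 0$ $$\int_0^\infty e^{-\mu(x,2x+R)}\,\mu(dx)=\infty\quad\text{and}\quad\int_{-\infty}^0 e^{-\mu(2x-R,x)}\,\mu(dx)=\infty,$$ then with probability $1$ the greedy walk on $\Pi$ exists and is recurrent. If at least one of the two integrals is finite for some $R\ge0$, then with probability $1$ the greedy walk on $\Pi$ exists and is transient. Moreover, with probability $1$, the greedy walk on $\Pi$ is recurrent if and only if $\Pi_\infty=\emptyset$, and transient if and only if $\Pi_\infty\ne\emptyset$. (b) Let $\lambda:\mathbb{R}\to[0,\infty)$ be a measurable function such that the measure $A\mapsto\int_A\lambda(x)\,dx$ belongs to $\mathcal{M}$, and let $\Pi$ be a Poisson process with this mean measure. If for every $R\ge0$ $$\int_0^\infty \exp\Big(-\int_x^{2x+R}\lambda(t)\,dt\Big)\lambda(x)\,dx=\infty\quad\text{and}\quad\int_{-\infty}^0\exp\Big(-\int_{2x-R}^x\lambda(t)\,dt\Big)\lambda(x)\,dx=\infty,$$ then with probability $1$ the greedy walk on $\Pi$ exists and is recurrent. If at least one of the two integrals is finite for some $R\ge0$,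 then with probability $1$ the greedy walk on $\Pi$ exists and is transient. -/

import Mathlib

open MeasureTheory ProbabilityTheory Filter
open scoped ENNReal

namespace GreedyWalk

section Walk

variable {E : Type*} [PseudoMetricSpace E]

/-- `unvisited pts S n` is the set `pts_n` of points of `pts` not visited up to and including time `n`:
`pts_0 = pts` and `pts_{n+1} = pts_n \ {S_{n+1}}`. -/
def unvisited (pts : Set E) (S : ℕ → E) : ℕ → Set E
  | 0 => pts
  | n + 1 => unvisited pts S n \ {S (n + 1)}

/-- The set `pts_∞ = ⋂_{n ≥ 1} pts_n` of points of `pts` that are never visited by the walk. -/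
def neverVisited (pts : Set E) (S : ℕ → E) : Set E :=
  ⋂ n : ℕ, unvisited pts S (n + 1)

/-- `S` is a greedy walk on `pts` started from `x₀`: at each step it moves to a point of `pts_n`
that minimises the distance to `S_n` (ties may be broken in any way). -/
structure IsGreedyWalk (pts : Set E) (x₀ : E) (S : ℕ → E) : Prop where
  start : S 0 = x₀
  mem_unvisited : ∀ n, S (n + 1) ∈ unvisited pts S n
  dist_le : ∀ n, ∀ X ∈ unvisited pts S n, dist (S n) (S (n + 1)) ≤ dist (S n) X

end Walk

/-- A trajectory on the line is recurrent if its sign changes infinitely often. -/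
def IsRecurrent (S : ℕ → ℝ) : Prop :=
  ∃ᶠ n in atTop, SignType.sign (S (n + 1)) ≠ SignType.sign (S n)

/-- A trajectory on the line is transient if it is not recurrent. -/
def IsTransient (S : ℕ → ℝ) : Prop := ¬ IsRecurrent S

/-- The class `𝓜`: infinite mass on both half-lines, finite mass on bounded measurable sets. -/
structure MemM (μ : Measure ℝ) : Prop where
  neg_infinite : μ (Set.Iio 0) = ∞
  pos_infinite : μ (Set.Ioi 0) = ∞
  bounded_finite : ∀ A : Set ℝ, MeasurableSet A → Bornology.IsBounded A → μ A < ∞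

/-- `pts(A)`, the number of points of the configuration `pts` in `A`. -/
noncomputable def count (pts A : Set ℝ) : ℕ∞ := (pts ∩ A).encard

/-- The random countable set `pts`, defined on the probability space `(Ω, P)`, is a Poisson process
with mean measure `μ`: the numbers of points in disjoint measurable sets are independent, and
`pts(A)` has the Poisson distribution with mean `μ A` (it is a.s. infinite if `μ A = ∞`). -/
structure IsPoissonProcess {Ω : Type*} [MeasurableSpace Ω] (P : Measure Ω)
    (pts : Ω → Set ℝ) (μ : Measure ℝ) : Prop where
  countable : ∀ ω, (pts ω).Countable
  measurable_count : ∀ A : Set ℝ, MeasurableSet A → Measurable fun ω => count (pts ω) A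
  law_finite : ∀ A : Set ℝ, MeasurableSet A → μ A < ∞ → ∀ k : ℕ,
    P {ω | count (pts ω) A = k} =
      ENNReal.ofReal (μ.real A ^ k / (k.factorial : ℝ) * Real.exp (-μ.real A))
  law_infinite : ∀ A : Set ℝ, MeasurableSet A → μ A = ∞ → ∀ᵐ ω ∂P, count (pts ω) A = ⊤
  indep : ∀ (n : ℕ) (A : Fin n → Set ℝ), (∀ i, MeasurableSet (A i)) →
    Pairwise (fun i j => Disjoint (A i) (A j)) →
    iIndepFun (fun (i : Fin n) (ω : Ω) => count (pts ω) (A i)) P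

/-- The greedy walk from `0` on the random configuration `pts` is recurrent with probability one. -/
def AlmostSurelyRecurrent {Ω : Type*} [MeasurableSpace Ω] (P : Measure Ω)
    (pts : Ω → Set ℝ) : Prop :=
  ∀ᵐ ω ∂P, (∃ S, IsGreedyWalk (pts ω) 0 S) ∧ ∀ S, IsGreedyWalk (pts ω) 0 S → IsRecurrent S

/-- The greedy walk from `0` on the random configuration `pts` is transient with probability one. -/
def AlmostSurelyTransient {Ω : Type*} [MeasurableSpace Ω] (P : Measure Ω)
    (pts : Ω → Set ℝ) : Prop :=
  ∀ᵐ ω ∂P, (∃ S, IsGreedyWalk (pts ω) 0 S) ∧ ∀ S, IsGreedyWalk (pts ω) 0 S → IsTransient S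

/-- `∫_0^∞ exp(-μ(x, 2x+R)) μ(dx)`, with values in `[0, ∞]`. -/
noncomputable def integralPos (μ : Measure ℝ) (R : ℝ) : ℝ≥0∞ :=
  ∫⁻ x in Set.Ioi (0 : ℝ), ENNReal.ofReal (Real.exp (-μ.real (Set.Ioo x (2 * x + R)))) ∂μ

/-- `∫_{-∞}^0 exp(-μ(2x-R, x)) μ(dx)`, with values in `[0, ∞]`. -/
noncomputable def integralNeg (μ : Measure ℝ) (R : ℝ) : ℝ≥0∞ :=
  ∫⁻ x in Set.Iio (0 : ℝ), ENNReal.ofReal (Real.exp (-μ.real (Set.Ioo (2 * x - R) x))) ∂μ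

/-- The measure `A ↦ ∫_A lam(x) dx` with intensity function `lam`. -/
noncomputable def intensityMeasure (lam : ℝ → ℝ) : Measure ℝ :=
  volume.withDensity fun x => ENNReal.ofReal (lam x)

/-- `∫_0^∞ exp(-∫_x^{2x+R} lam(t) dt) lam(x) dx`, with values in `[0, ∞]`. -/
noncomputable def intensityIntegralPos (lam : ℝ → ℝ) (R : ℝ) : ℝ≥0∞ :=
  ∫⁻ x in Set.Ioi (0 : ℝ), ENNReal.ofReal (Real.exp (-∫ t in x..(2 * x + R), lam t) * lam x)

/-- `∫_{-∞}^0 exp(-∫_{2x-R}^x lam(t) dt) lam(x) dx`, with values in `[0, ∞]`. -/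
noncomputable def intensityIntegralNeg (lam : ℝ → ℝ) (R : ℝ) : ℝ≥0∞ :=
  ∫⁻ x in Set.Iio (0 : ℝ), ENNReal.ofReal (Real.exp (-∫ t in (2 * x - R)..x, lam t) * lam x)

end GreedyWalk

/-! Since the visited points are always contiguous, a walk at `X > 0` stands at the right end of its
range and chooses between the next point on the right and the nearest unvisited point on the left.
If the latter is `Y < 0`, a crossing requires that `pts` have no point in `(X, 2X - Y)`, up to ties.
Recurrence is thus governed by the sets `gapPoints pts R` and their mirror images.

Deterministically, on a regular configuration: a recurrent walk makes `gapPoints pts R` unbounded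
for every `R` (`not_bddAbove_gapPoints_of_isRecurrent`), because its crossings start and land
arbitrarily far out. A walk that is eventually positive leaves some `Y < 0` unvisited, and with `R >
-Y` no distant gap point can occur (`exists_bddAbove_gapPoints`). Both arguments use strict
inequalities, so ties play no role.

Probabilistically, the half-line is cut into cells of length and mass at most one. The event that a
cell contains a point followed by a gap has probability comparable to the integral of `exp (-μ (x,
2x + R))` over the cell, after a shift of `R` by 2 that absorbs the cell length. If the integral is
finite, the first Borel–Cantelli lemma bounds the gap points. If it is infinite, a second
Borel–Cantelli lemma applies, since these events are pairwise negatively correlated. Reflection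
handles the negative half-line. -/

namespace GreedyWalk

/-! ### Greedy walks on a fixed configuration. -/

section Deterministic

/-- A locally finite configuration with infinitely many points on both sides of the origin and no
point at the origin. -/
structure IsRegular (pts : Set ℝ) : Prop where
  finite_Icc : ∀ n : ℕ, (pts ∩ Set.Icc (-(n : ℝ)) n).Finite
  infinite_pos : (pts ∩ Set.Ioi 0).Infinite
  infinite_neg : (pts ∩ Set.Iio 0).Infinite
  zero_notMem : (0 : ℝ) ∉ pts

/-- The positive points `X` of the configuration such that `(X, 2X + R)` contains no point. -/
def gapPoints (pts : Set ℝ) (R : ℝ) : Set ℝ :=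
  {X | X ∈ pts ∧ 0 < X ∧ pts ∩ Set.Ioo X (2 * X + R) = ∅}

variable {pts : Set ℝ} {S : ℕ → ℝ}

theorem IsRegular.finite_inter_Icc (h : IsRegular pts) (a b : ℝ) :
    (pts ∩ Set.Icc a b).Finite := by
  obtain ⟨n, hn⟩ := exists_nat_ge (max (-a) b)
  refine (h.finite_Icc n).subset ?_
  rintro x ⟨hx, hax, hxb⟩
  exact ⟨hx, by linarith [le_max_left (-a) b], hxb.trans ((le_max_right _ _).trans hn)⟩

theorem IsRegular.neg (h : IsRegular pts) : IsRegular (-pts) := by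
  refine ⟨fun n => ?_, ?_, ?_, by simpa using h.zero_notMem⟩
  · have := (h.finite_Icc n).neg
    rwa [Set.inter_neg, Set.neg_Icc, neg_neg] at this
  · intro hf
    refine h.infinite_neg ?_
    have := hf.neg
    rwa [Set.inter_neg, neg_neg, Set.neg_Ioi, neg_zero] at this
  · intro hf
    refine h.infinite_pos ?_
    have := hf.neg
    rwa [Set.inter_neg, neg_neg, Set.neg_Iio, neg_zero] at this

theorem unvisited_neg (pts : Set ℝ) (S : ℕ → ℝ) (n : ℕ) :
    unvisited (-pts) (-S) n = -unvisited pts S n := by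
  induction n with
  | zero => rfl
  | succ n ih => ext x; simp [unvisited, ih, neg_eq_iff_eq_neg]

theorem neverVisited_neg (pts : Set ℝ) (S : ℕ → ℝ) :
    neverVisited (-pts) (-S) = -neverVisited pts S := by
  simp only [neverVisited, unvisited_neg]
  ext x
  simp

theorem IsGreedyWalk.neg (h : IsGreedyWalk pts 0 S) : IsGreedyWalk (-pts) 0 (-S) := by
  refine ⟨by simp [h.start], fun n => ?_, fun n X hX => ?_⟩
  · simpa [unvisited_neg] using h.mem_unvisited n
  · rw [unvisited_neg] at hX
    have := h.dist_le n (-X) hX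
    rw [Pi.neg_apply, Pi.neg_apply, dist_neg_neg]
    calc _ ≤ _ := this
      _ = _ := by rw [← dist_neg_neg, neg_neg]

theorem isRecurrent_neg : IsRecurrent (-S) ↔ IsRecurrent S := by
  simp [IsRecurrent, Left.sign_neg]

theorem IsRegular.exists_nearest (h : IsRegular pts) {T : Set ℝ} (hT : T ⊆ pts)
    (hne : T.Nonempty) (x : ℝ) : ∃ y ∈ T, ∀ X ∈ T, dist x y ≤ dist x X := by
  obtain ⟨z, hz⟩ := hne
  have hfin : (T ∩ Metric.closedBall x (dist x z)).Finite := by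
    rw [Real.closedBall_eq_Icc]
    exact (h.finite_inter_Icc _ _).subset (Set.inter_subset_inter_left _ hT)
  obtain ⟨y, hy, hmin⟩ := Set.exists_min_image _ (fun y => dist x y) hfin
    ⟨z, hz, by simp [dist_comm]⟩
  refine ⟨y, hy.1, fun X hX => ?_⟩
  by_cases hXz : dist x X ≤ dist x z
  · exact hmin X ⟨hX, by rwa [Metric.mem_closedBall, dist_comm]⟩
  · exact (hmin z ⟨hz, by simp [dist_comm]⟩).trans (not_le.1 hXz).le

/-- A nearest point of `T` to `x`, whenever there is one. -/
noncomputable def nearest (x : ℝ) (T : Set ℝ) : ℝ :=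
  Classical.epsilon fun y => y ∈ T ∧ ∀ X ∈ T, dist x y ≤ dist x X

/-- The position of the walk together with its set of unvisited points. -/
noncomputable def walkState (pts : Set ℝ) : ℕ → ℝ × Set ℝ
  | 0 => (0, pts)
  | n + 1 => (nearest (walkState pts n).1 (walkState pts n).2,
      (walkState pts n).2 \ {nearest (walkState pts n).1 (walkState pts n).2})

/-- Only finitely many points are removed before any given time, so the unvisited set stays infinite
and the choice made by `nearest` is always a genuine minimiser. -/
theorem IsRegular.exists_isGreedyWalk (h : IsRegular pts) : ∃ S, IsGreedyWalk pts 0 S := by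
  have hunv : ∀ n, unvisited pts (fun n => (walkState pts n).1) n = (walkState pts n).2 := by
    intro n
    induction n with
    | zero => rfl
    | succ n ih => simp only [unvisited, ih, walkState]
  have hinf : ∀ n, (walkState pts n).2 ⊆ pts ∧ (walkState pts n).2.Infinite := by
    intro n
    induction n with
    | zero => exact ⟨subset_rfl, h.infinite_pos.mono Set.inter_subset_left⟩
    | succ n ih =>
      exact ⟨Set.sdiff_subset.trans ih.1, ih.2.sdiff (Set.finite_singleton _)⟩
  have hspec := fun n => Classical.epsilon_spec
    (h.exists_nearest (hinf n).1 (hinf n).2.nonempty (walkState pts n).1)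
  refine ⟨fun n => (walkState pts n).1, rfl, fun n => ?_, fun n => ?_⟩
  · rw [hunv]; exact (hspec n).1
  · rw [hunv]; exact (hspec n).2

theorem mem_unvisited_iff {n : ℕ} {x : ℝ} :
    x ∈ unvisited pts S n ↔ x ∈ pts ∧ ∀ i < n, x ≠ S (i + 1) := by
  induction n with
  | zero => simp [unvisited]
  | succ n ih =>
    simp only [unvisited, Set.mem_sdiff, ih, Set.mem_singleton_iff, Nat.lt_succ_iff_lt_or_eq]
    constructor
    · rintro ⟨⟨h1, h2⟩, h3⟩
      refine ⟨h1, ?_⟩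
      rintro i (hi | rfl)
      exacts [h2 i hi, h3]
    · rintro ⟨h1, h2⟩
      exact ⟨⟨h1, fun i hi => h2 i (.inl hi)⟩, h2 n (.inr rfl)⟩

theorem mem_neverVisited_iff {x : ℝ} :
    x ∈ neverVisited pts S ↔ x ∈ pts ∧ ∀ i, x ≠ S (i + 1) := by
  simp only [neverVisited, Set.mem_iInter, mem_unvisited_iff]
  exact ⟨fun h => ⟨(h 0).1, fun i => (h i).2 i i.lt_succ_self⟩,
    fun h n => ⟨h.1, fun i _ => h.2 i⟩⟩

theorem neverVisited_subset_unvisited {n : ℕ} : neverVisited pts S ⊆ unvisited pts S n := by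
  intro x hx
  rw [mem_neverVisited_iff] at hx
  exact mem_unvisited_iff.2 ⟨hx.1, fun i _ => hx.2 i⟩

/-- The walk has only finitely many negative positions, whereas `pts` has infinitely many negative
points. -/
theorem IsRegular.exists_neg_mem_neverVisited (h : IsRegular pts) (hp : ∀ᶠ n in atTop, 0 < S n) :
    ∃ Y ∈ neverVisited pts S, Y < 0 := by
  obtain ⟨N, hN⟩ := eventually_atTop.1 hp
  obtain ⟨Y, hY, hYS⟩ := (h.infinite_neg.sdiff ((Set.finite_Iio N).image S)).nonempty
  refine ⟨Y, mem_neverVisited_iff.2 ⟨hY.1, fun i hi => ?_⟩, hY.2⟩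
  by_cases hiN : i + 1 < N
  · exact hYS ⟨i + 1, hiN, hi.symm⟩
  · exact lt_asymm hY.2 (hi ▸ hN (i + 1) (not_lt.1 hiN))

/-! ### Sign changes, unvisited points and gap points. -/

namespace IsGreedyWalk

variable (hS : IsGreedyWalk pts 0 S) (h : IsRegular pts)
include hS

theorem mem_pts (n : ℕ) : S (n + 1) ∈ pts := (mem_unvisited_iff.1 (hS.mem_unvisited n)).1

include h

theorem ne_zero (n : ℕ) : S (n + 1) ≠ 0 := fun h0 => h.zero_notMem (h0 ▸ hS.mem_pts n)

theorem injective : Function.Injective S := by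
  have key : ∀ i j, i < j → S j ≠ S i := by
    intro i j hij
    obtain ⟨j, rfl⟩ := Nat.exists_eq_succ_of_ne_zero (by omega : j ≠ 0)
    cases i with
    | zero => rw [hS.start]; exact hS.ne_zero h j
    | succ i => exact (mem_unvisited_iff.1 (hS.mem_unvisited j)).2 i (by omega)
  intro i j hij
  rcases lt_trichotomy i j with hlt | heq | hgt
  exacts [(key _ _ hlt hij.symm).elim, heq, (key _ _ hgt hij).elim]

/-- The points visited up to a given time are contiguous. -/
theorem lt_or_gt_of_mem_unvisited (n : ℕ) :
    ∀ X ∈ unvisited pts S n, (∀ i ≤ n, S i < X) ∨ (∀ i ≤ n, X < S i) := by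
  induction n with
  | zero =>
    intro X hX
    have hX0 : X ≠ 0 := fun h0 => h.zero_notMem (h0 ▸ hX)
    rcases hX0.lt_or_gt with hlt | hgt
    · right; intro i hi; obtain rfl : i = 0 := by omega
      rwa [hS.start]
    · left; intro i hi; obtain rfl : i = 0 := by omega
      rwa [hS.start]
  | succ n ih =>
    rintro X ⟨hX, hne⟩
    have hd := hS.dist_le n X hX
    rw [Real.dist_eq, Real.dist_eq] at hd
    rcases ih X hX with hlt | hgt
    · left
      intro i hi
      rcases hi.lt_or_eq with hi | rfl
      · exact hlt i (by omega)
      · by_contra hc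
        have h1 : X < S (n + 1) := lt_of_le_of_ne (not_lt.1 hc) hne
        have h2 := hlt n le_rfl
        rw [abs_of_neg (by linarith), abs_of_neg (by linarith)] at hd
        linarith
    · right
      intro i hi
      rcases hi.lt_or_eq with hi | rfl
      · exact hgt i (by omega)
      · by_contra hc
        have h1 : S (n + 1) < X := lt_of_le_of_ne (not_lt.1 hc) (Ne.symm hne)
        have h2 := hgt n le_rfl
        rw [abs_of_pos (by linarith), abs_of_pos (by linarith)] at hd
        linarith

theorem eventually_notMem_Icc (a b : ℝ) : ∀ᶠ n in atTop, S n ∉ Set.Icc a b := by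
  have hfin : {n | S n ∈ Set.Icc a b}.Finite := by
    -- The point 0 is inserted because the start `S 0` does not belong to `pts`.
    refine Set.Finite.of_finite_image (f := S) (((h.finite_inter_Icc a b).insert 0).subset ?_)
      (hS.injective h).injOn
    rintro _ ⟨n, hn, rfl⟩
    cases n with
    | zero => left; exact hS.start
    | succ n => right; exact ⟨hS.mem_pts n, hn⟩
  rw [← Nat.cofinite_eq_atTop]
  exact hfin.compl_mem_cofinite

/-- A newly reached positive point lies to the right of the previous trajectory. -/
theorem lt_of_pos {n : ℕ} (hn : 0 < S n) {i : ℕ} (hi : i < n) : S i < S n := by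
  obtain ⟨n, rfl⟩ := Nat.exists_eq_succ_of_ne_zero (by omega : n ≠ 0)
  rcases hS.lt_or_gt_of_mem_unvisited h n _ (hS.mem_unvisited n) with hlt | hgt
  · exact hlt i (by omega)
  · have := hgt 0 (Nat.zero_le _)
    rw [hS.start] at this
    exact absurd hn this.not_gt

theorem mem_unvisited_of_gt {n : ℕ} (hn : 0 < S n) {X : ℝ} (hX : X ∈ pts) (hlt : S n < X) :
    X ∈ unvisited pts S n := by
  refine mem_unvisited_iff.2 ⟨hX, fun i hi hXi => ?_⟩
  rcases (show i + 1 ≤ n from hi).lt_or_eq with hi | hi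
  · exact lt_asymm hlt (hXi ▸ hS.lt_of_pos h hn hi)
  · rw [hi] at hXi; exact hlt.ne' hXi

/-- After time 0 the walk avoids the origin, so its sign takes only two values and each change
exhibits both of them. -/
theorem isRecurrent_iff :
    IsRecurrent S ↔ (∃ᶠ n in atTop, 0 < S n) ∧ (∃ᶠ n in atTop, S n < 0) := by
  constructor
  · intro hr
    have key : ∀ N, ∃ n ≥ N, SignType.sign (S (n + 1)) ≠ SignType.sign (S n) ∧ S n ≠ 0 ∧
        S (n + 1) ≠ 0 := by
      intro N
      obtain ⟨n, hn, hs⟩ := frequently_atTop.1 hr (N + 1)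
      obtain ⟨m, rfl⟩ := Nat.exists_eq_succ_of_ne_zero (by omega : n ≠ 0)
      exact ⟨m + 1, by omega, hs, hS.ne_zero h m, hS.ne_zero h _⟩
    simp only [frequently_atTop]
    constructor
    all_goals
      intro N
      obtain ⟨n, hn, hs, h0, h1⟩ := key N
      rcases h0.lt_or_gt with h0 | h0 <;> rcases h1.lt_or_gt with h1 | h1
    · simp [sign_neg, h0, h1] at hs
    · exact ⟨n + 1, by omega, h1⟩
    · exact ⟨n, hn, h0⟩
    · simp [sign_pos, h0, h1] at hs
    · simp [sign_neg, h0, h1] at hs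
    · exact ⟨n, hn, h0⟩
    · exact ⟨n + 1, by omega, h1⟩
    · simp [sign_pos, h0, h1] at hs
  · rintro ⟨hp, hn⟩
    rw [IsRecurrent, frequently_atTop]
    intro N
    by_contra! hc
    have hconst : ∀ k, SignType.sign (S (N + k)) = SignType.sign (S N) := by
      intro k
      induction k with
      | zero => rfl
      | succ k ih => rw [← ih]; exact hc (N + k) (by omega)
    obtain ⟨a, ha, hpa⟩ := frequently_atTop.1 hp N
    obtain ⟨b, hb, hnb⟩ := frequently_atTop.1 hn N
    have h1 := hconst (a - N)
    have h2 := hconst (b - N)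
    rw [Nat.add_sub_cancel' ha, sign_pos hpa] at h1
    rw [Nat.add_sub_cancel' hb, sign_neg hnb, ← h1] at h2
    exact absurd h2 (by decide)

theorem eventually_pos_or_neg (ht : ¬ IsRecurrent S) :
    (∀ᶠ n in atTop, 0 < S n) ∨ (∀ᶠ n in atTop, S n < 0) := by
  rw [hS.isRecurrent_iff h, not_and_or, not_frequently, not_frequently] at ht
  have hne : ∀ᶠ n in atTop, S n ≠ 0 := by
    filter_upwards [eventually_ge_atTop 1] with n hn
    obtain ⟨m, rfl⟩ := Nat.exists_eq_succ_of_ne_zero (by omega : n ≠ 0)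
    exact hS.ne_zero h m
  rcases ht with ht | ht
  · right
    filter_upwards [ht, hne] with n h1 h2
    exact lt_of_le_of_ne (not_lt.1 h1) h2
  · left
    filter_upwards [ht, hne] with n h1 h2
    exact lt_of_le_of_ne (not_lt.1 h1) h2.symm

theorem exists_lt_of_frequently_pos (hp : ∃ᶠ n in atTop, 0 < S n) (M : ℝ) : ∃ n, M < S n := by
  obtain ⟨n, hn, hM⟩ := (hp.and_eventually (hS.eventually_notMem_Icc h 0 M)).exists
  exact ⟨n, by by_contra hc; exact hM ⟨hn.le, not_lt.1 hc⟩⟩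

/-- The trajectory passes every level on both sides, so an unvisited point would lie strictly inside
the visited range, contradicting contiguity. -/
theorem neverVisited_eq_empty_of_isRecurrent (hr : IsRecurrent S) : neverVisited pts S = ∅ := by
  obtain ⟨hp, hn⟩ := (hS.isRecurrent_iff h).1 hr
  rw [Set.eq_empty_iff_forall_notMem]
  intro X hX
  obtain ⟨a, ha⟩ := hS.exists_lt_of_frequently_pos h hp X
  obtain ⟨b, hb⟩ := hS.neg.exists_lt_of_frequently_pos h.neg
    (hn.mono fun n hn => by simpa using hn) (-X)
  rw [Pi.neg_apply, neg_lt_neg_iff] at hb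
  rcases hS.lt_or_gt_of_mem_unvisited h (max a b) X (neverVisited_subset_unvisited hX) with h1 | h1
  · exact lt_asymm ha (h1 a (le_max_left _ _))
  · exact lt_asymm hb (h1 b (le_max_right _ _))

theorem neverVisited_nonempty_of_not_isRecurrent (ht : ¬ IsRecurrent S) :
    (neverVisited pts S).Nonempty := by
  rcases hS.eventually_pos_or_neg h ht with hp | hn
  · obtain ⟨Y, hY, -⟩ := h.exists_neg_mem_neverVisited hp
    exact ⟨Y, hY⟩
  · obtain ⟨Y, hY, -⟩ := h.neg.exists_neg_mem_neverVisited (S := -S)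
      (hn.mono fun n hn => by simpa using hn)
    rw [neverVisited_neg] at hY
    exact ⟨-Y, hY⟩

/-- Take a late crossing from `X > M` to a point below `-R`. Its length exceeds `X + R`, so a point
in `(X, 2X + R)` would have been preferred; hence `X` is a gap point beyond `M`. -/
theorem not_bddAbove_gapPoints_of_isRecurrent (hr : IsRecurrent S) (R : ℝ) :
    ¬ BddAbove (gapPoints pts R) := by
  obtain ⟨hp, hn⟩ := (hS.isRecurrent_iff h).1 hr
  rintro ⟨M, hM⟩
  obtain ⟨N, hN⟩ := eventually_atTop.1
    ((hS.eventually_notMem_Icc h (-R) 0).and (hS.eventually_notMem_Icc h 0 (max M 0)))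
  obtain ⟨a, haN, ha⟩ := frequently_atTop.1 hp N
  obtain ⟨b, hba, hb⟩ := frequently_atTop.1 hn a
  -- The crossing is the step into the first negative position after time `a`.
  have hex : ∃ k, S (a + k) < 0 := ⟨b - a, by rwa [Nat.add_sub_cancel' hba]⟩
  obtain ⟨k, hk⟩ := Nat.exists_eq_succ_of_ne_zero
    (show Nat.find hex ≠ 0 by rw [Ne, Nat.find_eq_zero]; exact ha.not_gt)
  have hneg : S (a + k + 1) < 0 := by
    have := Nat.find_spec hex
    rwa [hk] at this
  have hnn : 0 ≤ S (a + k) := not_lt.1 (Nat.find_min hex (by omega : k < Nat.find hex))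
  have hM' : max M 0 < S (a + k) := by
    by_contra hc
    exact (hN (a + k) (by omega)).2 ⟨hnn, not_lt.1 hc⟩
  have hR : S (a + k + 1) < -R := by
    by_contra hc
    exact (hN (a + k + 1) (by omega)).1 ⟨not_lt.1 hc, hneg.le⟩
  have hpos : 0 < S (a + k) := (le_max_right _ _).trans_lt hM'
  have hmem : S (a + k) ∈ pts := by
    cases hc : a + k with
    | zero => rw [hc, hS.start] at hpos; exact absurd hpos (lt_irrefl _)
    | succ m => exact hS.mem_pts m
  refine ((le_max_left M 0).trans_lt hM').not_ge (hM ⟨hmem, hpos, ?_⟩)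
  rw [Set.eq_empty_iff_forall_notMem]
  rintro Y ⟨hY, h1, h2⟩
  have hd := hS.dist_le (a + k) Y (hS.mem_unvisited_of_gt h hpos hY h1)
  rw [Real.dist_eq, Real.dist_eq, abs_of_pos (by linarith), abs_of_neg (by linarith)] at hd
  linarith

/-- Let `Y < 0` be never visited and `R > -Y`. A gap point beyond `S N` is visited at a time when
the walk stays positive, so the next step has length at least `X + R > X - Y`, although `Y` was
available. -/
theorem exists_bddAbove_gapPoints (hp : ∀ᶠ n in atTop, 0 < S n) :
    ∃ R : ℕ, BddAbove (gapPoints pts R) := by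
  obtain ⟨Y, hY, hY0⟩ := h.exists_neg_mem_neverVisited hp
  obtain ⟨R, hR⟩ := exists_nat_gt (-Y)
  obtain ⟨N, hN⟩ := eventually_atTop.1 hp
  refine ⟨R, S N, ?_⟩
  rintro X ⟨hX, hX0, hgap⟩
  by_contra! hc
  -- The walk passes `X`, and by contiguity it cannot skip a positive point.
  obtain ⟨m, rfl⟩ : ∃ m, X = S m := by
    by_contra! hv
    obtain ⟨n, hn⟩ := hS.exists_lt_of_frequently_pos h hp.frequently X
    have hXn : X ∈ unvisited pts S n := mem_unvisited_iff.2 ⟨hX, fun i _ => hv _⟩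
    rcases hS.lt_or_gt_of_mem_unvisited h n X hXn with h1 | h1
    · exact lt_asymm hn (h1 n le_rfl)
    · have := h1 0 (Nat.zero_le _)
      rw [hS.start] at this
      exact lt_asymm hX0 this
  have hNm : N < m := by
    by_contra hm
    rcases (not_lt.1 hm).lt_or_eq with hm | rfl
    · exact lt_asymm hc (hS.lt_of_pos h (hN N le_rfl) hm)
    · exact lt_irrefl _ hc
  have hstep : S m < S (m + 1) := hS.lt_of_pos h (hN (m + 1) (by omega)) (by omega)
  have hge : 2 * S m + R ≤ S (m + 1) := by
    by_contra! hlt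
    exact (Set.eq_empty_iff_forall_notMem.1 hgap) _ ⟨hS.mem_pts m, hstep, hlt⟩
  have hd := hS.dist_le m Y (neverVisited_subset_unvisited hY)
  rw [Real.dist_eq, Real.dist_eq, abs_of_pos (by linarith : 0 < S m - Y),
    abs_of_neg (by linarith)] at hd
  linarith

end IsGreedyWalk

end Deterministic

end GreedyWalk

namespace GreedyWalk

/-! ### Borel–Cantelli and Poisson estimates for gaps. -/

section Probability

variable {Ω : Type*} [MeasurableSpace Ω] {P : Measure Ω}

/-- **Second Borel–Cantelli lemma** for pairwise negatively correlated events. -/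
theorem ae_frequently_mem_of_measure_inter_le [IsProbabilityMeasure P] {A : ℕ → Set Ω}
    (hA : ∀ k, MeasurableSet (A k)) (hsum : ∑' k, P (A k) = ∞)
    (hneg : ∀ j k, j < k → P (A j ∩ A k) ≤ P (A j) * P (A k)) :
    ∀ᵐ ω ∂P, ∃ᶠ k in atTop, ω ∈ A k := by
  let X : ℕ → Ω → ℝ := fun k => (A k).indicator 1
  have hX : ∀ k, MemLp (X k) 2 P := fun k => memLp_indicator_const 2 (hA k) 1 (.inr (by simp))
  have hEX : ∀ k, P[X k] = P.real (A k) := fun k => integral_indicator_one (hA k)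
  have hXX : ∀ j k, P[X j * X k] = P.real (A j ∩ A k) := by
    intro j k
    rw [← integral_indicator_one ((hA j).inter (hA k)), Set.inter_indicator_one]
  -- Off the diagonal the covariance is nonpositive; on it, `p - p ^ 2 ≤ p`. Hence the variance of
  -- the partial sums is at most their mean, and Chebyshev's inequality gives a bound that tends to
  -- 0.
  have hcov : ∀ j k, cov[X j, X k; P] ≤ if j = k then P.real (A j) else 0 := by
    intro j k
    rw [covariance_eq_sub (hX j) (hX k), hXX, hEX, hEX]
    split_ifs with hjk
    · subst hjk
      rw [Set.inter_self]
      nlinarith [measureReal_nonneg (μ := P) (s := A j)]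
    · rw [sub_nonpos]
      have : P (A j ∩ A k) ≤ P (A j) * P (A k) := by
        rcases lt_or_gt_of_ne hjk with hlt | hgt
        · exact hneg j k hlt
        · rw [Set.inter_comm, mul_comm]; exact hneg k j hgt
      simpa [measureReal_def, ENNReal.toReal_mul] using ENNReal.toReal_mono (by finiteness) this
  let m : ℕ → ℝ := fun n => ∑ k ∈ Finset.range n, P.real (A k)
  have hm : Tendsto m atTop atTop := by
    refine (not_summable_iff_tendsto_nat_atTop_of_nonneg fun _ => measureReal_nonneg).1 fun hs => ?_
    refine hs.tsum_ofReal_ne_top ?_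
    rw [← hsum]
    exact tsum_congr fun k => ofReal_measureReal
  have hmean : ∀ n, P[∑ k ∈ Finset.range n, X k] = m n := by
    intro n
    simp only [Finset.sum_apply]
    rw [integral_finsetSum _ fun k _ => (hX k).integrable (by norm_num)]
    exact Finset.sum_congr rfl fun k _ => hEX k
  have hvar : ∀ n, Var[∑ k ∈ Finset.range n, X k; P] ≤ m n := by
    intro n
    rw [variance_sum' fun k _ => hX k]
    refine Finset.sum_le_sum fun i hi => ?_
    calc _ ≤ ∑ j ∈ Finset.range n, if i = j then P.real (A i) else 0 :=
          Finset.sum_le_sum fun j _ => hcov i j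
      _ = P.real (A i) := by rw [Finset.sum_ite_eq, if_pos hi]
  have hnull : ∀ K : ℕ, ∀ᵐ ω ∂P, ¬ ∀ k ≥ K, ω ∉ A k := by
    intro K
    rw [ae_iff]
    simp only [not_not]
    have hbound : ∀ᶠ n in atTop, P {ω | ∀ k ≥ K, ω ∉ A k} ≤ ENNReal.ofReal (4 / m n) := by
      -- If no event occurs from index `K` on, the sum is at most `K < m n / 2`, a deviation of at
      -- least `m n / 2` from its mean.
      filter_upwards [hm.eventually_ge_atTop (2 * K + 1)] with n hn
      have hmpos : 0 < m n := by linarith [K.cast_nonneg (α := ℝ)]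
      have hcheb := meas_ge_le_variance_div_sq (μ := P)
        (memLp_finsetSum' (Finset.range n) fun k _ => hX k) (half_pos hmpos)
      rw [hmean] at hcheb
      refine (measure_mono ?_).trans (hcheb.trans (ENNReal.ofReal_le_ofReal ?_))
      · intro ω hω
        have hle : (∑ k ∈ Finset.range n, X k) ω ≤ K := by
          rw [Finset.sum_apply]
          calc ∑ k ∈ Finset.range n, X k ω
              ≤ ∑ k ∈ Finset.range n, if k < K then (1 : ℝ) else 0 := by
                refine Finset.sum_le_sum fun k _ => ?_
                split_ifs with hk
                · exact Set.indicator_le_self' (fun _ _ => zero_le_one) ω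
                · exact (Set.indicator_of_notMem (hω k (not_lt.1 hk)) _).le
            _ ≤ K := by
                rw [← Finset.sum_filter, Finset.sum_const, nsmul_eq_mul, mul_one, Nat.cast_le]
                calc _ ≤ (Finset.range K).card := Finset.card_le_card fun k hk => by
                      simpa using (Finset.mem_filter.1 hk).2
                  _ = K := Finset.card_range K
        change m n / 2 ≤ |_ - m n|
        rw [abs_sub_comm]
        exact le_trans (by linarith) (le_abs_self _)
      · calc _ ≤ m n / (m n / 2) ^ 2 := by gcongr; exact hvar n
          _ = 4 / m n := by field_simp; norm_num
    refine le_antisymm (ge_of_tendsto ?_ hbound) zero_le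
    have : Tendsto (fun n => 4 / m n) atTop (nhds 0) := hm.const_div_atTop 4
    simpa using ENNReal.tendsto_ofReal this
  filter_upwards [ae_all_iff.2 hnull] with ω hω
  rw [frequently_atTop]
  intro K
  have := hω K
  push Not at this
  exact this

theorem count_eq_zero {pts A : Set ℝ} : count pts A = 0 ↔ pts ∩ A = ∅ := Set.encard_eq_zero

theorem count_eq_zero_mono {pts A B : Set ℝ} (h : A ⊆ B) (hB : count pts B = 0) :
    count pts A = 0 := by
  rw [count_eq_zero] at *
  exact Set.subset_eq_empty (Set.inter_subset_inter_right _ h) hB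

/-- The event that there is a point in `I` and no point in `J`. -/
def gapEvent (pts : Ω → Set ℝ) (I J : Set ℝ) : Set Ω :=
  {ω | count (pts ω) I ≠ 0 ∧ count (pts ω) J = 0}

namespace IsPoissonProcess

variable {pts : Ω → Set ℝ} {μ : Measure ℝ}

theorem measure_iInter_count (h : IsPoissonProcess P pts μ) {n : ℕ} (A : Fin n → Set ℝ)
    (hA : ∀ i, MeasurableSet (A i)) (hd : Pairwise fun i j => Disjoint (A i) (A j))
    (B : Fin n → Set ℕ∞) :
    P (⋂ i, {ω | count (pts ω) (A i) ∈ B i}) = ∏ i, P {ω | count (pts ω) (A i) ∈ B i} :=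
  (h.indep n A hA hd).meas_iInter fun i => ⟨B i, .of_discrete, rfl⟩

theorem measure_count_eq_zero (h : IsPoissonProcess P pts μ) {A : Set ℝ} (hA : MeasurableSet A)
    (hfin : μ A < ∞) :
    P {ω | count (pts ω) A = 0} = ENNReal.ofReal (Real.exp (-μ.real A)) := by
  simpa using h.law_finite A hA hfin 0

theorem measurableSet_count (h : IsPoissonProcess P pts μ) {A : Set ℝ} (hA : MeasurableSet A)
    (B : Set ℕ∞) : MeasurableSet {ω | count (pts ω) A ∈ B} :=
  h.measurable_count A hA .of_discrete

theorem measure_count_ne_zero [IsProbabilityMeasure P] (h : IsPoissonProcess P pts μ)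
    {A : Set ℝ} (hA : MeasurableSet A) (hfin : μ A < ∞) :
    P {ω | count (pts ω) A ≠ 0} = ENNReal.ofReal (1 - Real.exp (-μ.real A)) := by
  have : {ω | count (pts ω) A ≠ 0} = {ω | count (pts ω) A = 0}ᶜ := rfl
  rw [this, prob_compl_eq_one_sub (show MeasurableSet {ω | count (pts ω) A = 0} from
    h.measurableSet_count hA {0}), h.measure_count_eq_zero hA hfin,
    ENNReal.ofReal_sub _ (Real.exp_pos _).le, ENNReal.ofReal_one]

theorem measurableSet_gapEvent (h : IsPoissonProcess P pts μ) {I J : Set ℝ}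
    (hI : MeasurableSet I) (hJ : MeasurableSet J) : MeasurableSet (gapEvent pts I J) :=
  (h.measurableSet_count hI {0}ᶜ).inter (h.measurableSet_count hJ {0})

theorem measure_gapEvent_eq_mul (h : IsPoissonProcess P pts μ) {I J : Set ℝ}
    (hI : MeasurableSet I) (hJ : MeasurableSet J) (hIJ : Disjoint I J) :
    P (gapEvent pts I J) = P {ω | count (pts ω) I ≠ 0} * P {ω | count (pts ω) J = 0} := by
  have := h.measure_iInter_count ![I, J] (by simp [Fin.forall_fin_two, hI, hJ])
    (by intro i j hij; fin_cases i <;> fin_cases j <;> simp_all [disjoint_comm])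
    ![{0}ᶜ, {0}]
  simp only [Fin.prod_univ_two, Matrix.cons_val_zero, Matrix.cons_val_one] at this
  refine Eq.trans ?_ this
  congr 1
  ext ω
  simp [gapEvent, Fin.forall_fin_two]

theorem measure_gapEvent [IsProbabilityMeasure P] (h : IsPoissonProcess P pts μ) {I J : Set ℝ}
    (hI : MeasurableSet I) (hJ : MeasurableSet J) (hIJ : Disjoint I J) (hIfin : μ I < ∞)
    (hJfin : μ J < ∞) :
    P (gapEvent pts I J) =
      ENNReal.ofReal (1 - Real.exp (-μ.real I)) * ENNReal.ofReal (Real.exp (-μ.real J)) := by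
  rw [h.measure_gapEvent_eq_mul hI hJ hIJ, h.measure_count_ne_zero hI hIfin,
    h.measure_count_eq_zero hJ hJfin]

/-- If `I' ⊆ J`, the two events exclude each other. Otherwise an empty `J` forces the point of `I'`
into `I' \ J`; the sets `I`, `J`, `I' \ J`, `J'` are disjoint, so independence applies, and
enlarging `I' \ J` to `I'` only increases the probability. -/
theorem measure_inter_gapEvent_le (h : IsPoissonProcess P pts μ) {I J I' J' : Set ℝ}
    (hI : MeasurableSet I) (hJ : MeasurableSet J) (hI' : MeasurableSet I')
    (hJ' : MeasurableSet J') (hIJ : Disjoint I J) (hIJ' : Disjoint I' J')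
    (hII' : Disjoint I I') (hIJ'' : Disjoint I J') (hcase : I' ⊆ J ∨ Disjoint J J') :
    P (gapEvent pts I J ∩ gapEvent pts I' J') ≤
      P (gapEvent pts I J) * P (gapEvent pts I' J') := by
  rcases hcase with hsub | hJJ'
  · have : gapEvent pts I J ∩ gapEvent pts I' J' = ∅ := by
      rw [Set.eq_empty_iff_forall_notMem]
      rintro ω ⟨⟨-, h1⟩, h2, -⟩
      exact h2 (count_eq_zero_mono hsub h1)
    simp [this]
  · have h1 : Disjoint I (I' \ J) := hII'.mono_right Set.sdiff_subset
    have h2 : Disjoint (I' \ J) J' := hIJ'.mono_left Set.sdiff_subset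
    have h3 : Disjoint J (I' \ J) := Set.disjoint_sdiff_right
    have key := h.measure_iInter_count ![I, J, I' \ J, J']
      (by intro i; fin_cases i <;> simp [hI, hJ, hI'.diff hJ, hJ'])
      (by
        intro i j hij
        fin_cases i <;> fin_cases j <;>
          first
          | exact absurd rfl hij
          | exact hIJ
          | exact hIJ.symm
          | exact h1
          | exact h1.symm
          | exact h2
          | exact h2.symm
          | exact h3
          | exact h3.symm
          | exact hIJ''
          | exact hIJ''.symm
          | exact hJJ'
          | exact hJJ'.symm)
      ![{0}ᶜ, {0}, {0}ᶜ, {0}]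
    rw [h.measure_gapEvent_eq_mul hI hJ hIJ, h.measure_gapEvent_eq_mul hI' hJ' hIJ']
    calc P (gapEvent pts I J ∩ gapEvent pts I' J')
        ≤ P (⋂ i, {ω | count (pts ω) (![I, J, I' \ J, J'] i) ∈
            (![{0}ᶜ, {0}, {0}ᶜ, {0}] : Fin 4 → Set ℕ∞) i}) := by
          refine measure_mono ?_
          rintro ω ⟨⟨hc1, hc2⟩, hc3, hc4⟩
          have hc5 : count (pts ω) (I' \ J) ≠ 0 := by
            intro hc
            refine hc3 ?_
            rw [count_eq_zero, Set.eq_empty_iff_forall_notMem] at *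
            exact fun x hx => (em (x ∈ J)).elim (fun hxJ => hc2 x ⟨hx.1, hxJ⟩)
              fun hxJ => hc x ⟨hx.1, hx.2, hxJ⟩
          refine Set.mem_iInter.2 fun i => ?_
          fin_cases i
          exacts [hc1, hc2, hc5, hc4]
      _ = P {ω | count (pts ω) I ≠ 0} * P {ω | count (pts ω) J = 0} *
            P {ω | count (pts ω) (I' \ J) ≠ 0} * P {ω | count (pts ω) J' = 0} := by
          rw [key, Fin.prod_univ_four]; rfl
      _ ≤ P {ω | count (pts ω) I ≠ 0} * P {ω | count (pts ω) J = 0} *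
            P {ω | count (pts ω) I' ≠ 0} * P {ω | count (pts ω) J' = 0} := by
          gcongr P {ω | count (pts ω) I ≠ 0} * P {ω | count (pts ω) J = 0} * P ?_ * _
          exact fun ω hω hc => hω (count_eq_zero_mono Set.sdiff_subset hc)
      _ = _ := by rw [mul_assoc]

end IsPoissonProcess

/-! ### Discretisation of the integral by cells. -/

/-- A division of the positive half-line into intervals of length and mass at most one. -/
structure IsUnitGrid (μ : Measure ℝ) (t : ℕ → ℝ) : Prop where
  zero : t 0 = 0
  mono : Monotone t
  mesh : ∀ k, t (k + 1) ≤ t k + 1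
  mass : ∀ k, μ (Set.Ioc (t k) (t (k + 1))) ≤ 1
  tendsto : Tendsto t atTop atTop

variable {μ : Measure ℝ} {t : ℕ → ℝ}

/-- For `b ≥ 0`, `G b` is `b` plus the mass of `(0, b]`. It is strictly increasing, and continuous
because there are no atoms; with `t k` the preimage of `k`, the length and mass of each cell add up
to exactly 1. -/
theorem exists_isUnitGrid [IsLocallyFiniteMeasure μ] [NullSingletonClass μ] :
    ∃ t, IsUnitGrid μ t := by
  let G : ℝ → ℝ := fun b => b + ∫ _ in (0 : ℝ)..b, (1 : ℝ) ∂μ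
  have hint : ∀ a b, IntervalIntegrable (fun _ => (1 : ℝ)) μ a b :=
    fun a b => intervalIntegrable_const
  have hcont : Continuous G :=
    continuous_id.add (intervalIntegral.continuous_primitive hint 0)
  have hdiff : ∀ a b, a ≤ b → G b - G a = (b - a) + μ.real (Set.Ioc a b) := by
    intro a b hab
    have := intervalIntegral.integral_interval_sub_left (hint 0 b) (hint 0 a)
    rw [intervalIntegral.integral_of_le hab, setIntegral_const, smul_eq_mul, mul_one] at this
    simp only [G]
    linarith
  have hmono : StrictMono G := by
    intro a b hab
    have := hdiff a b hab.le
    have := measureReal_nonneg (μ := μ) (s := Set.Ioc a b)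
    linarith
  have hG0 : G 0 = 0 := by simp [G]
  have htop : Tendsto G atTop atTop := by
    refine tendsto_atTop_mono' _ ?_ tendsto_id
    filter_upwards [eventually_ge_atTop 0] with b hb
    have := hdiff 0 b hb
    have := measureReal_nonneg (μ := μ) (s := Set.Ioc 0 b)
    simp only [id]
    linarith
  have hbot : Tendsto G atBot atBot := by
    refine tendsto_atBot_mono' _ ?_ tendsto_id
    filter_upwards [eventually_le_atBot 0] with b hb
    have := hdiff b 0 hb
    have := measureReal_nonneg (μ := μ) (s := Set.Ioc b 0)
    simp only [id]
    linarith
  choose t ht using fun k : ℕ => hcont.surjective htop hbot k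
  have htm : Monotone t := fun j k hjk => by
    rw [← hmono.le_iff_le, ht, ht]; exact_mod_cast hjk
  have hstep : ∀ k, (t (k + 1) - t k) + μ.real (Set.Ioc (t k) (t (k + 1))) = 1 := by
    intro k
    rw [← hdiff _ _ (htm k.le_succ), ht, ht]
    push_cast
    ring
  refine ⟨t, ?_, htm, fun k => ?_, fun k => ?_, ?_⟩
  · exact hmono.injective (by rw [ht, hG0, Nat.cast_zero])
  · have := hstep k
    have := measureReal_nonneg (μ := μ) (s := Set.Ioc (t k) (t (k + 1)))
    linarith
  · have h1 := hstep k
    have h2 := htm k.le_succ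
    rw [← ENNReal.ofReal_one, ← ofReal_measureReal (μ := μ) (s := Set.Ioc (t k) (t (k + 1)))
      measure_Ioc_lt_top.ne]
    exact ENNReal.ofReal_le_ofReal (by linarith)
  · refine tendsto_atTop_atTop.2 fun b => ?_
    obtain ⟨N, hN⟩ := exists_nat_ge (G b)
    refine ⟨N, fun k hk => ?_⟩
    rw [← hmono.le_iff_le, ht]
    exact hN.trans (by exact_mod_cast hk)

namespace IsUnitGrid

theorem iUnion_Ioc (h : IsUnitGrid μ t) : ⋃ k, Set.Ioc (t k) (t (k + 1)) = Set.Ioi 0 := by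
  rw [← h.zero]
  exact iUnion_Ioc_map_succ_eq_Ioi (fun k => h.mono (Nat.zero_le k))
    (not_bddAbove_of_tendsto_atTop h.tendsto)

theorem lintegral_Ioi (h : IsUnitGrid μ t) (f : ℝ → ℝ≥0∞) :
    ∫⁻ x in Set.Ioi 0, f x ∂μ = ∑' k, ∫⁻ x in Set.Ioc (t k) (t (k + 1)), f x ∂μ := by
  rw [← h.iUnion_Ioc]
  exact lintegral_iUnion (fun _ => measurableSet_Ioc) h.mono.pairwise_disjoint_on_Ioc_succ _

theorem exists_mem (h : IsUnitGrid μ t) {x : ℝ} (hx : 0 < x) :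
    ∃ k, x ∈ Set.Ioc (t k) (t (k + 1)) := by
  have : x ∈ Set.Ioi (0 : ℝ) := hx
  rwa [← h.iUnion_Ioc, Set.mem_iUnion] at this

theorem measureReal_le_one (h : IsUnitGrid μ t) (k : ℕ) :
    μ.real (Set.Ioc (t k) (t (k + 1))) ≤ 1 :=
  ENNReal.toReal_le_of_le_ofReal zero_le_one (by simpa using h.mass k)

variable [IsLocallyFiniteMeasure μ]

/-- The part of the interval inside the cell has mass at most 1. For the rest, `x ≤ t k + 1` gives
`2x + R ≤ 2 t k + (R + 2)`, an endpoint that no longer depends on `x`. -/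
theorem measureReal_Ioo_le (h : IsUnitGrid μ t) {k : ℕ} {x : ℝ}
    (hx : x ∈ Set.Ioc (t k) (t (k + 1))) (R : ℝ) :
    μ.real (Set.Ioo x (2 * x + R)) ≤ 1 + μ.real (Set.Ioo (t (k + 1)) (2 * t k + (R + 2))) := by
  have hsub : Set.Ioo x (2 * x + R) ⊆
      Set.Ioc (t k) (t (k + 1)) ∪ Set.Ioo (t (k + 1)) (2 * t k + (R + 2)) := by
    rintro y ⟨h1, h2⟩
    by_cases hy : y ≤ t (k + 1)
    · exact .inl ⟨hx.1.trans h1, hy⟩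
    · exact .inr ⟨not_le.1 hy, by linarith [hx.2, h.mesh k]⟩
  calc _ ≤ _ := measureReal_mono hsub
          (measure_union_lt_top measure_Ioc_lt_top measure_Ioo_lt_top).ne
    _ ≤ _ := measureReal_union_le _ _
    _ ≤ _ := by gcongr; exact h.measureReal_le_one k

theorem le_measureReal_Ioo (h : IsUnitGrid μ t) {k : ℕ} {x : ℝ}
    (hx : x ∈ Set.Ioc (t k) (t (k + 1))) (R : ℝ) :
    μ.real (Set.Ioo (t (k + 1)) (2 * t (k + 1) + R)) ≤ μ.real (Set.Ioo x (2 * x + (R + 2))) := by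
  refine measureReal_mono (fun y hy => ⟨hx.2.trans_lt hy.1, ?_⟩) measure_Ioo_lt_top.ne
  linarith [hy.2, hx.1, h.mesh k]

end IsUnitGrid

variable [IsProbabilityMeasure P] {pts : Ω → Set ℝ}

/-- First Borel–Cantelli lemma. `J k` is contained in `(X, 2X + R + 2)` for every `X` in `I k`, so a
gap point in the cell forces the gap event, whose probability is at most `e` times the integral over
the cell. -/
theorem IsPoissonProcess.ae_bddAbove_gapPoints [IsLocallyFiniteMeasure μ] [NullSingletonClass μ]
    (h : IsPoissonProcess P pts μ) {R : ℝ} (hR : integralPos μ R < ∞) :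
    ∀ᵐ ω ∂P, BddAbove (gapPoints (pts ω) (R + 2)) := by
  obtain ⟨t, ht⟩ := exists_isUnitGrid (μ := μ)
  let I : ℕ → Set ℝ := fun k => Set.Ioc (t k) (t (k + 1))
  let J : ℕ → Set ℝ := fun k => Set.Ioo (t (k + 1)) (2 * t k + (R + 2))
  have hle : ∀ k, P (gapEvent pts (I k) (J k)) ≤ ENNReal.ofReal (Real.exp 1) *
      ∫⁻ x in I k, ENNReal.ofReal (Real.exp (-μ.real (Set.Ioo x (2 * x + R)))) ∂μ := by
    intro k
    have hdisj : Disjoint (I k) (J k) :=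
      Set.disjoint_left.2 fun y hy hy' => hy.2.not_gt hy'.1
    rw [h.measure_gapEvent measurableSet_Ioc measurableSet_Ioo hdisj measure_Ioc_lt_top
      measure_Ioo_lt_top]
    have hlow : ENNReal.ofReal (Real.exp (-(1 + μ.real (J k)))) * μ (I k) ≤
        ∫⁻ x in I k, ENNReal.ofReal (Real.exp (-μ.real (Set.Ioo x (2 * x + R)))) ∂μ := by
      rw [← setLIntegral_const]
      refine setLIntegral_mono' measurableSet_Ioc fun x hx => ?_
      gcongr
      exact ht.measureReal_Ioo_le hx R
    -- This uses `1 - exp (-m) ≤ m`; the factor `exp 1` then cancels the mass 1 allowed within the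
    -- cell.
    calc _ ≤ ENNReal.ofReal (μ.real (I k)) * ENNReal.ofReal (Real.exp (-μ.real (J k))) := by
          gcongr
          linarith [Real.add_one_le_exp (-μ.real (I k))]
      _ = ENNReal.ofReal (Real.exp 1) *
            (ENNReal.ofReal (Real.exp (-(1 + μ.real (J k)))) * μ (I k)) := by
          rw [ofReal_measureReal measure_Ioc_lt_top.ne, ← mul_assoc,
            ← ENNReal.ofReal_mul (Real.exp_pos _).le, ← Real.exp_add, mul_comm]
          congr 3
          ring
      _ ≤ _ := by gcongr
  have hsum : ∑' k, P (gapEvent pts (I k) (J k)) ≠ ∞ := by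
    refine ne_top_of_le_ne_top ?_ (ENNReal.tsum_le_tsum hle)
    rw [ENNReal.tsum_mul_left, ← ht.lintegral_Ioi]
    exact ENNReal.mul_ne_top ENNReal.ofReal_ne_top hR.ne
  filter_upwards [ae_eventually_notMem hsum] with ω hω
  obtain ⟨K, hK⟩ := eventually_atTop.1 hω
  refine ⟨t K, ?_⟩
  rintro X ⟨hX, hX0, hgap⟩
  by_contra! hc
  obtain ⟨k, hk⟩ := ht.exists_mem hX0
  refine hK k ?_ ⟨?_, ?_⟩
  · by_contra! hkK
    exact (hk.2.trans (ht.mono hkK)).not_gt hc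
  · rw [Ne, count_eq_zero, ← Ne, ← Set.nonempty_iff_ne_empty]
    exact ⟨X, hX, hk⟩
  · have hsub : J k ⊆ Set.Ioo X (2 * X + (R + 2)) := fun y hy =>
      ⟨hk.2.trans_lt hy.1, by linarith [hy.2, hk.1]⟩
    exact count_eq_zero_mono hsub (count_eq_zero.2 hgap)

/-- Here `J k` is long enough that, when the gap event occurs, the rightmost point of the cell is a
gap point. The gap events occur infinitely often by negative correlation. -/
theorem IsPoissonProcess.ae_not_bddAbove_gapPoints [IsLocallyFiniteMeasure μ]
    [NullSingletonClass μ] (h : IsPoissonProcess P pts μ) (hreg : ∀ᵐ ω ∂P, IsRegular (pts ω))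
    {R : ℝ} (hR : integralPos μ (R + 2) = ∞) :
    ∀ᵐ ω ∂P, ¬ BddAbove (gapPoints (pts ω) R) := by
  obtain ⟨t, ht⟩ := exists_isUnitGrid (μ := μ)
  let I : ℕ → Set ℝ := fun k => Set.Ioc (t k) (t (k + 1))
  let J : ℕ → Set ℝ := fun k => Set.Ioo (t (k + 1)) (2 * t (k + 1) + R)
  have hdisj : ∀ k, Disjoint (I k) (J k) := fun k =>
    Set.disjoint_left.2 fun y hy hy' => hy.2.not_gt hy'.1
  have hle : ∀ k, ∫⁻ x in I k, ENNReal.ofReal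
      (Real.exp (-μ.real (Set.Ioo x (2 * x + (R + 2))))) ∂μ ≤
        2 * P (gapEvent pts (I k) (J k)) := by
    intro k
    rw [h.measure_gapEvent measurableSet_Ioc measurableSet_Ioo (hdisj k) measure_Ioc_lt_top
      measure_Ioo_lt_top]
    have hm0 : 0 ≤ μ.real (I k) := measureReal_nonneg
    have hm1 : μ.real (I k) ≤ 1 := ht.measureReal_le_one k
    -- For `0 ≤ m ≤ 1`, `1 - exp (-m) ≥ m / (1 + m) ≥ m / 2`.
    have hexp : μ.real (I k) ≤ 2 * (1 - Real.exp (-μ.real (I k))) := by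
      have h1 : Real.exp (-μ.real (I k)) * (1 + μ.real (I k)) ≤ 1 := by
        calc _ ≤ Real.exp (-μ.real (I k)) * Real.exp (μ.real (I k)) := by
              gcongr; linarith [Real.add_one_le_exp (μ.real (I k))]
          _ = 1 := by rw [← Real.exp_add]; simp
      have h2 := Real.exp_pos (-μ.real (I k))
      nlinarith
    calc _ ≤ ∫⁻ _ in I k, ENNReal.ofReal (Real.exp (-μ.real (J k))) ∂μ := by
          refine setLIntegral_mono' measurableSet_Ioc fun x hx => ?_
          exact ENNReal.ofReal_le_ofReal
            (Real.exp_le_exp.2 (neg_le_neg (ht.le_measureReal_Ioo hx R)))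
      _ = ENNReal.ofReal (μ.real (I k)) * ENNReal.ofReal (Real.exp (-μ.real (J k))) := by
          rw [setLIntegral_const, ofReal_measureReal measure_Ioc_lt_top.ne, mul_comm]
      _ ≤ ENNReal.ofReal (2 * (1 - Real.exp (-μ.real (I k)))) *
            ENNReal.ofReal (Real.exp (-μ.real (J k))) := by gcongr
      _ = _ := by rw [ENNReal.ofReal_mul zero_le_two, mul_assoc, ENNReal.ofReal_ofNat]
  have hsum : ∑' k, P (gapEvent pts (I k) (J k)) = ∞ := by
    have : integralPos μ (R + 2) ≤ 2 * ∑' k, P (gapEvent pts (I k) (J k)) := by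
      rw [integralPos, ht.lintegral_Ioi, ← ENNReal.tsum_mul_left]
      exact ENNReal.tsum_le_tsum hle
    rw [hR, top_le_iff] at this
    by_contra hc
    exact ENNReal.mul_ne_top (by simp) hc this
  have hneg : ∀ j k, j < k → P (gapEvent pts (I j) (J j) ∩ gapEvent pts (I k) (J k)) ≤
      P (gapEvent pts (I j) (J j)) * P (gapEvent pts (I k) (J k)) := by
    intro j k hjk
    have h1 : t (j + 1) ≤ t k := ht.mono hjk
    have h2 : t k ≤ t (k + 1) := ht.mono k.le_succ
    refine h.measure_inter_gapEvent_le measurableSet_Ioc measurableSet_Ioo measurableSet_Ioc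
      measurableSet_Ioo (hdisj j) (hdisj k) ?_ ?_ ?_
    · exact Set.disjoint_left.2 fun y hy hy' => (hy.2.trans h1).not_gt hy'.1
    · exact Set.disjoint_left.2 fun y hy hy' => (hy.2.trans (h1.trans h2)).not_gt hy'.1
    -- Either the later cell ends before `J j` does and so lies inside it, or `J k` starts beyond
    -- the end of `J j`.
    · by_cases hc : t (k + 1) < 2 * t (j + 1) + R
      · exact .inl fun y hy => ⟨h1.trans_lt hy.1, hy.2.trans_lt hc⟩
      · exact .inr (Set.disjoint_left.2 fun y hy hy' =>
          (hy.2.trans_le (not_lt.1 hc)).not_gt hy'.1)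
  filter_upwards [hreg, ae_frequently_mem_of_measure_inter_le
    (fun k => h.measurableSet_gapEvent measurableSet_Ioc measurableSet_Ioo) hsum hneg]
    with ω hω hfreq
  rintro ⟨M, hM⟩
  obtain ⟨k, ⟨hk1, hk2⟩, hk⟩ :=
    (hfreq.and_eventually (ht.tendsto.eventually_ge_atTop M)).exists
  rw [Ne, count_eq_zero, ← Ne, ← Set.nonempty_iff_ne_empty] at hk1
  rw [count_eq_zero, Set.eq_empty_iff_forall_notMem] at hk2
  obtain ⟨X, hX, hmax⟩ := Set.exists_max_image _ id
    ((hω.finite_inter_Icc (t k) (t (k + 1))).subset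
      (Set.inter_subset_inter_right _ Set.Ioc_subset_Icc_self)) hk1
  have h0 : 0 ≤ t k := ht.zero ▸ ht.mono (Nat.zero_le k)
  refine (hk.trans_lt hX.2.1).not_ge (hM ⟨hX.1, h0.trans_lt hX.2.1, ?_⟩)
  rw [Set.eq_empty_iff_forall_notMem]
  rintro Y ⟨hY, h1, h2⟩
  by_cases hYt : Y ≤ t (k + 1)
  · exact (hmax Y ⟨hY, hX.2.1.trans h1, hYt⟩).not_gt h1
  · exact hk2 Y ⟨hY, not_le.1 hYt, by linarith [hX.2.2]⟩

end Probability

end GreedyWalk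

namespace GreedyWalk

/-! ### Almost sure regularity, reflection and assembly. -/

section Main

variable {Ω : Type*} [MeasurableSpace Ω] {P : Measure Ω} {pts : Ω → Set ℝ} {μ : Measure ℝ}

theorem MemM.isFiniteMeasureOnCompacts (h : MemM μ) : IsFiniteMeasureOnCompacts μ :=
  ⟨fun K hK => h.bounded_finite K hK.measurableSet hK.isBounded⟩

namespace IsPoissonProcess

/-- The Poisson weights of the finite values already sum to 1, leaving no mass for `⊤`. -/
theorem ae_count_ne_top [IsProbabilityMeasure P] (h : IsPoissonProcess P pts μ) {A : Set ℝ}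
    (hA : MeasurableSet A) (hfin : μ A < ∞) : ∀ᵐ ω ∂P, count (pts ω) A ≠ ⊤ := by
  have hunion : {ω | count (pts ω) A ≠ ⊤} = ⋃ k : ℕ, {ω | count (pts ω) A = k} := by
    ext ω
    simp only [Set.mem_ofPred_eq, Set.mem_iUnion, ENat.ne_top_iff_exists, eq_comm]
  have hmeas : ∀ B : Set ℕ∞, MeasurableSet {ω | count (pts ω) A ∈ B} :=
    h.measurableSet_count hA
  refine (mem_ae_iff_prob_eq_one (hmeas {⊤}ᶜ)).2 ?_
  change P {ω | count (pts ω) A ≠ ⊤} = 1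
  rw [hunion, measure_iUnion _ fun k : ℕ => show MeasurableSet {ω | count (pts ω) A = k} from
    hmeas {(k : ℕ∞)}]
  · have hsum := hasSum_one_poissonMeasure (μ.real A).toNNReal
    rw [Real.coe_toNNReal _ measureReal_nonneg] at hsum
    simp_rw [h.law_finite A hA hfin]
    rw [← ENNReal.ofReal_tsum_of_nonneg (fun k => by positivity)]
    · rw [← ENNReal.ofReal_one, ← hsum.tsum_eq]
      congr 1
      exact tsum_congr fun k => by ring
    · exact hsum.summable.congr fun k => by ring
  · intro i j hij
    refine Set.disjoint_left.2 fun ω hi hj => hij ?_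
    exact_mod_cast (hi : count (pts ω) A = i).symm.trans hj

theorem ae_isRegular [IsProbabilityMeasure P] [NullSingletonClass μ] (hM : MemM μ)
    (h : IsPoissonProcess P pts μ) : ∀ᵐ ω ∂P, IsRegular (pts ω) := by
  have hfin : ∀ n : ℕ, ∀ᵐ ω ∂P, count (pts ω) (Set.Icc (-(n : ℝ)) n) ≠ ⊤ := fun n =>
    h.ae_count_ne_top measurableSet_Icc
      (hM.bounded_finite _ measurableSet_Icc (Metric.isBounded_Icc _ _))
  have hzero : ∀ᵐ ω ∂P, count (pts ω) {0} = 0 := by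
    refine (mem_ae_iff_prob_eq_one (h.measurableSet_count (measurableSet_singleton 0) {0})).2 ?_
    refine (h.measure_count_eq_zero (measurableSet_singleton 0) (by simp)).trans ?_
    simp [measureReal_def]
  filter_upwards [ae_all_iff.2 hfin, hzero, h.law_infinite _ measurableSet_Ioi hM.pos_infinite,
    h.law_infinite _ measurableSet_Iio hM.neg_infinite] with ω h1 h2 h3 h4
  refine ⟨fun n => Set.encard_ne_top_iff.1 (h1 n), Set.encard_eq_top_iff.1 h3,
    Set.encard_eq_top_iff.1 h4, fun h0 => ?_⟩
  rw [count_eq_zero, Set.eq_empty_iff_forall_notMem] at h2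
  exact h2 0 ⟨h0, rfl⟩

end IsPoissonProcess

theorem count_neg (s A : Set ℝ) : count (-s) A = count s (-A) := by
  have : -s ∩ A = Neg.neg '' (s ∩ -A) := by
    rw [Set.image_neg_eq_neg, Set.inter_neg, neg_neg]
  rw [count, this, neg_injective.encard_image, count]

theorem map_neg_apply (μ : Measure ℝ) (A : Set ℝ) :
    μ.map (MeasurableEquiv.neg ℝ) A = μ (-A) :=
  (MeasurableEquiv.neg ℝ).map_apply A

theorem MemM.map_neg (h : MemM μ) : MemM (μ.map (MeasurableEquiv.neg ℝ)) := by
  refine ⟨?_, ?_, fun A hA hb => ?_⟩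
  · rw [map_neg_apply, Set.neg_Iio, neg_zero, h.pos_infinite]
  · rw [map_neg_apply, Set.neg_Ioi, neg_zero, h.neg_infinite]
  · rw [map_neg_apply]
    exact h.bounded_finite _ hA.neg hb.neg

theorem nullSingletonClass_map_neg [NullSingletonClass μ] :
    NullSingletonClass (μ.map (MeasurableEquiv.neg ℝ)) :=
  ⟨fun x => by rw [map_neg_apply, Set.neg_singleton, measure_singleton]⟩

theorem IsPoissonProcess.neg (h : IsPoissonProcess P pts μ) :
    IsPoissonProcess P (fun ω => -pts ω) (μ.map (MeasurableEquiv.neg ℝ)) := by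
  refine ⟨fun ω => ?_, fun A hA => ?_, fun A hA hfin k => ?_, fun A hA hinf => ?_,
    fun n A hA hd => ?_⟩
  · rw [← Set.image_neg_eq_neg]
    exact (h.countable ω).image _
  · simp_rw [count_neg]
    exact h.measurable_count _ hA.neg
  · rw [map_neg_apply] at hfin
    simp_rw [count_neg, measureReal_def, map_neg_apply]
    exact h.law_finite _ hA.neg hfin k
  · rw [map_neg_apply] at hinf
    simp_rw [count_neg]
    exact h.law_infinite _ hA.neg hinf
  · simp_rw [count_neg]
    exact h.indep n (fun i => -A i) (fun i => (hA i).neg)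
      fun i j hij => (hd hij).preimage Neg.neg

theorem integralPos_map_neg (μ : Measure ℝ) (R : ℝ) :
    integralPos (μ.map (MeasurableEquiv.neg ℝ)) R = integralNeg μ R := by
  rw [integralPos, integralNeg, (MeasurableEquiv.neg ℝ).measurableEmbedding.restrict_map,
    lintegral_map_equiv]
  have : (MeasurableEquiv.neg ℝ) ⁻¹' Set.Ioi 0 = Set.Iio 0 := by ext; simp
  rw [this]
  refine lintegral_congr fun x => ?_
  rw [measureReal_def, measureReal_def, map_neg_apply, Set.neg_Ioo]
  change ENNReal.ofReal (Real.exp (-(μ (Set.Ioo (-(2 * -x + R)) (- -x))).toReal)) = _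
  rw [neg_neg, show -(2 * -x + R) = 2 * x - R by ring]

variable [IsProbabilityMeasure P] [NullSingletonClass μ]

theorem almostSurelyRecurrent (hM : MemM μ) (h : IsPoissonProcess P pts μ)
    (hR : ∀ R : ℝ, 0 ≤ R → integralPos μ R = ∞ ∧ integralNeg μ R = ∞) :
    AlmostSurelyRecurrent P pts := by
  have := hM.isFiniteMeasureOnCompacts
  have := hM.map_neg.isFiniteMeasureOnCompacts
  have := nullSingletonClass_map_neg (μ := μ)
  -- Natural values of `R` suffice for the deterministic criterion, so only countably many null sets
  -- are discarded.
  have hpos : ∀ᵐ ω ∂P, ∀ R : ℕ, ¬ BddAbove (gapPoints (pts ω) R) :=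
    ae_all_iff.2 fun R => h.ae_not_bddAbove_gapPoints (h.ae_isRegular hM) (hR _ (by positivity)).1
  have hneg : ∀ᵐ ω ∂P, ∀ R : ℕ, ¬ BddAbove (gapPoints (-pts ω) R) :=
    ae_all_iff.2 fun R => h.neg.ae_not_bddAbove_gapPoints (h.neg.ae_isRegular hM.map_neg)
      (by rw [integralPos_map_neg]; exact (hR _ (by positivity)).2)
  filter_upwards [h.ae_isRegular hM, hpos, hneg] with ω hω h1 h2
  refine ⟨hω.exists_isGreedyWalk, fun S hS => ?_⟩
  by_contra hr
  rcases hS.eventually_pos_or_neg hω hr with hp | hn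
  · obtain ⟨R, hb⟩ := hS.exists_bddAbove_gapPoints hω hp
    exact h1 R hb
  · obtain ⟨R, hb⟩ := hS.neg.exists_bddAbove_gapPoints hω.neg
      (hn.mono fun n hn => by simpa using hn)
    exact h2 R hb

theorem almostSurelyTransient (hM : MemM μ) (h : IsPoissonProcess P pts μ)
    (hR : ∃ R : ℝ, integralPos μ R < ∞ ∨ integralNeg μ R < ∞) :
    AlmostSurelyTransient P pts := by
  have := hM.isFiniteMeasureOnCompacts
  have := hM.map_neg.isFiniteMeasureOnCompacts
  have := nullSingletonClass_map_neg (μ := μ)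
  obtain ⟨R, hR | hR⟩ := hR
  · filter_upwards [h.ae_isRegular hM, h.ae_bddAbove_gapPoints hR] with ω hω hb
    exact ⟨hω.exists_isGreedyWalk,
      fun S hS hr => hS.not_bddAbove_gapPoints_of_isRecurrent hω hr _ hb⟩
  · rw [← integralPos_map_neg] at hR
    filter_upwards [h.ae_isRegular hM, h.neg.ae_bddAbove_gapPoints hR] with ω hω hb
    exact ⟨hω.exists_isGreedyWalk, fun S hS hr =>
      hS.neg.not_bddAbove_gapPoints_of_isRecurrent hω.neg (isRecurrent_neg.2 hr) _ hb⟩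

omit [IsProbabilityMeasure P] [NullSingletonClass μ]

theorem IsGreedyWalk.isRecurrent_iff_neverVisited_eq_empty {s : Set ℝ} {S : ℕ → ℝ}
    (hS : IsGreedyWalk s 0 S) (h : IsRegular s) : IsRecurrent S ↔ neverVisited s S = ∅ := by
  refine ⟨hS.neverVisited_eq_empty_of_isRecurrent h, fun he => ?_⟩
  by_contra hr
  exact (hS.neverVisited_nonempty_of_not_isRecurrent h hr).ne_empty he

/-- No integrability is needed: if the mass is infinite, both sides take the default value 0. -/
theorem measureReal_intensityMeasure_Ioo {lam : ℝ → ℝ} (hlam : Measurable lam)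
    (h0 : ∀ x, 0 ≤ lam x) {a b : ℝ} (hab : a ≤ b) :
    (intensityMeasure lam).real (Set.Ioo a b) = ∫ t in a..b, lam t := by
  rw [intervalIntegral.integral_of_le hab, integral_Ioc_eq_integral_Ioo,
    integral_eq_lintegral_of_nonneg_ae (ae_of_all _ h0) hlam.aestronglyMeasurable,
    measureReal_def, intensityMeasure, withDensity_apply _ measurableSet_Ioo]

/-- `hR` ensures `x ≤ 2 * x + R` for positive `x`, so the oriented integral is the mass of the
interval. -/
theorem integralPos_intensityMeasure {lam : ℝ → ℝ} (hlam : Measurable lam)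
    (h0 : ∀ x, 0 ≤ lam x) {R : ℝ} (hR : 0 ≤ R) :
    integralPos (intensityMeasure lam) R = intensityIntegralPos lam R := by
  rw [integralPos, intensityIntegralPos]
  refine (setLIntegral_withDensity_eq_setLIntegral_mul_non_measurable _ hlam.ennreal_ofReal _
    measurableSet_Ioi (ae_of_all _ fun _ => ENNReal.ofReal_lt_top)).trans ?_
  refine setLIntegral_congr_fun measurableSet_Ioi fun x hx => ?_
  have hx' : (0 : ℝ) < x := hx
  rw [Pi.mul_apply, measureReal_intensityMeasure_Ioo hlam h0 (by linarith), mul_comm,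
    ENNReal.ofReal_mul (Real.exp_pos _).le]

theorem integralNeg_intensityMeasure {lam : ℝ → ℝ} (hlam : Measurable lam)
    (h0 : ∀ x, 0 ≤ lam x) {R : ℝ} (hR : 0 ≤ R) :
    integralNeg (intensityMeasure lam) R = intensityIntegralNeg lam R := by
  rw [integralNeg, intensityIntegralNeg]
  refine (setLIntegral_withDensity_eq_setLIntegral_mul_non_measurable _ hlam.ennreal_ofReal _
    measurableSet_Iio (ae_of_all _ fun _ => ENNReal.ofReal_lt_top)).trans ?_
  refine setLIntegral_congr_fun measurableSet_Iio fun x hx => ?_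
  have hx' : x < (0 : ℝ) := hx
  rw [Pi.mul_apply, measureReal_intensityMeasure_Ioo hlam h0 (by linarith), mul_comm,
    ENNReal.ofReal_mul (Real.exp_pos _).le]

end Main

end GreedyWalk

theorem theorem1 {Ω : Type*} [MeasurableSpace Ω] (P : Measure Ω) [IsProbabilityMeasure P] :
    (∀ (μ : Measure ℝ) [NullSingletonClass μ] (pts : Ω → Set ℝ),
      GreedyWalk.MemM μ → GreedyWalk.IsPoissonProcess P pts μ →
        ((∀ R : ℝ, 0 ≤ R →
            GreedyWalk.integralPos μ R = ∞ ∧ GreedyWalk.integralNeg μ R = ∞) →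
          GreedyWalk.AlmostSurelyRecurrent P pts) ∧
        ((∃ R : ℝ, 0 ≤ R ∧
            (GreedyWalk.integralPos μ R < ∞ ∨ GreedyWalk.integralNeg μ R < ∞)) →
          GreedyWalk.AlmostSurelyTransient P pts) ∧
        (∀ᵐ ω ∂P, ∀ S : ℕ → ℝ, GreedyWalk.IsGreedyWalk (pts ω) 0 S →
          ((GreedyWalk.IsRecurrent S ↔ GreedyWalk.neverVisited (pts ω) S = ∅) ∧
            (GreedyWalk.IsTransient S ↔ (GreedyWalk.neverVisited (pts ω) S).Nonempty)))) ∧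
    (∀ (lam : ℝ → ℝ) (pts : Ω → Set ℝ), Measurable lam → (∀ x, 0 ≤ lam x) →
      GreedyWalk.MemM (GreedyWalk.intensityMeasure lam) →
      GreedyWalk.IsPoissonProcess P pts (GreedyWalk.intensityMeasure lam) →
        ((∀ R : ℝ, 0 ≤ R →
            GreedyWalk.intensityIntegralPos lam R = ∞ ∧
              GreedyWalk.intensityIntegralNeg lam R = ∞) →
          GreedyWalk.AlmostSurelyRecurrent P pts) ∧
        ((∃ R : ℝ, 0 ≤ R ∧
            (GreedyWalk.intensityIntegralPos lam R < ∞ ∨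
              GreedyWalk.intensityIntegralNeg lam R < ∞)) →
          GreedyWalk.AlmostSurelyTransient P pts)) := by
  refine ⟨fun μ _ pts hM h => ⟨GreedyWalk.almostSurelyRecurrent hM h, ?_, ?_⟩,
    fun lam pts hlam h0 hM h => ⟨fun hR => ?_, ?_⟩⟩
  · rintro ⟨R, -, hR⟩
    exact GreedyWalk.almostSurelyTransient hM h ⟨R, hR⟩
  · filter_upwards [h.ae_isRegular hM] with ω hω S hS
    have hiff := hS.isRecurrent_iff_neverVisited_eq_empty hω
    exact ⟨hiff, by rw [GreedyWalk.IsTransient, hiff, Set.nonempty_iff_ne_empty]⟩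
  · have : NullSingletonClass (GreedyWalk.intensityMeasure lam) :=
      nullSingletonClass_withDensity _
    refine GreedyWalk.almostSurelyRecurrent hM h fun R hR0 => ?_
    rw [GreedyWalk.integralPos_intensityMeasure hlam h0 hR0,
      GreedyWalk.integralNeg_intensityMeasure hlam h0 hR0]
    exact hR R hR0
  · have : NullSingletonClass (GreedyWalk.intensityMeasure lam) :=
      nullSingletonClass_withDensity _
    rintro ⟨R, hR0, hR⟩
    rw [← GreedyWalk.integralPos_intensityMeasure hlam h0 hR0,
      ← GreedyWalk.integralNeg_intensityMeasure hlam h0 hR0] at hR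
    exact GreedyWalk.almostSurelyTransient hM h ⟨R, hR⟩
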